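/- Let $m\in\mathbb N$, let $0<\epsilon<1$ and $0<\delta<1$, and let $x=(x_j)_{j\in\mathbb N}\in\ell_2$ be a real square-summable sequence with $\|x\|_2=1$. Let $h:\mathbb N\to\{1,\dots,m\}$ and $\xi:\mathbb N\to\{\pm1\}$ be random hash functions: the values $h(j)$ are uniform on $\{1,\dots,m\}$, the values $\xi(j)$ are uniform on $\{\pm1\}$, and all of the $h(j)$ and $\xi(j)$, $j\in\mathbb N$, are mutually independent. For $1\le i\le m$ put $$\phi_i(x)=\sum_{j:\,h(j)=i}\xi(j)\,x_j ,\qquad \|x\|_\phi^2=\langle\phi(x),\phi(x)\rangle=\sum_{i=1}^m\phi_i(x)^2 ,$$ where the series are summed in the natural order of $j$. Suppose that $$m\ \ge\ \frac{72\log(1/\delta)}{\epsilon^2}\qquad\text{and}\qquad \|x\|_\infty=\sup_j|x_j|\ \le\ \frac{\epsilon}{18\sqrt{\log(1/\delta)\,\log(m/\delta)}} .$$ Then almost surely all the series $\phi_i(x)$ converge, and $$\Pr\big[\,\big|\|x\|_\phi^2-1\big|\ge\epsilon\,\big]\ \le\ 2\delta .$$ -/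

import Mathlib

open MeasureTheory ProbabilityTheory
open scoped ENNReal

noncomputable section

namespace FeatureHashing

/-- The space of real square-summable sequences. -/
abbrev L2 : Type := lp (fun _ : ℕ => ℝ) 2

/-- The supremum norm of a square-summable sequence (such a sequence is bounded). -/
def supNorm (x : L2) : ℝ := ⨆ j : ℕ, |x j|

/-- The `j`-th term `ξ(j) x_j 1[h(j) = i]` of the series that defines bucket `i`. -/
def bucketTerm {m : ℕ} (h : ℕ → Fin m) (ξ : ℕ → ℤˣ) (x : L2) (i : Fin m) (j : ℕ) : ℝ :=
  if h j = i then ((ξ j : ℤ) : ℝ) * x j else 0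

/-- Convergence of all the bucket series, as limits of the partial sums over `j < N`, `N → ∞`. -/
def HashConverges {m : ℕ} (h : ℕ → Fin m) (ξ : ℕ → ℤˣ) (x : L2) : Prop :=
  ∀ i : Fin m, Summable (bucketTerm h ξ x i) (SummationFilter.conditional ℕ)

/-- The signed hashed feature map `φ_i(x) = ∑_{j : h(j) = i} ξ(j) x_j`. The series is summed in the
natural order of `j` (a square-summable sequence need not be absolutely summable). -/
def hashMap {m : ℕ} (h : ℕ → Fin m) (ξ : ℕ → ℤˣ) (x : L2) : EuclideanSpace ℝ (Fin m) :=
  WithLp.toLp 2 fun i => ∑'[SummationFilter.conditional ℕ] j : ℕ, bucketTerm h ξ x i j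

/-- The hashed inner product `⟨x, x'⟩_φ = ⟨φ(x), φ(x')⟩`. -/
def hashInner {m : ℕ} (h : ℕ → Fin m) (ξ : ℕ → ℤˣ) (x x' : L2) : ℝ :=
  inner ℝ (hashMap h ξ x) (hashMap h ξ x')

/-- The hashed squared norm `‖x‖²_φ = ⟨x, x⟩_φ`. -/
def hashNormSq {m : ℕ} (h : ℕ → Fin m) (ξ : ℕ → ℤˣ) (x : L2) : ℝ :=
  hashInner h ξ x x

/-- The law of a random pair of hash functions `(h, ξ)`: the values `h(j)` are uniform on the `m`
buckets, the values `ξ(j)` are uniform signs, and all these values are independent. -/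
def hashLaw (m : ℕ) : Measure ((ℕ → Fin m) × (ℕ → ℤˣ)) :=
  (Measure.infinitePi fun _ : ℕ => uniformOn (Set.univ : Set (Fin m))).prod
    (Measure.infinitePi fun _ : ℕ => uniformOn (Set.univ : Set ℤˣ))

end FeatureHashing

end

/-!
For a fixed hash function `h`, the bucket values `φ_i` are independent Rademacher sums, and the mean
of `∑ φ_i²` over the signs is exactly `∑ x_j² = 1`. Hence the deviation is a matter of concentration
in the signs alone, and it is governed by the largest bucket mass `∑_{h(j) = i} x_j²`.

Write `L = log (1/δ)` and `K = log (m/δ)`, and let `s = ε² / (36 L)`.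

* Every bucket has mass at most `s`, except with probability `δ`
  (`measure_compl_lightHashes_le`). The mass of a bucket has mean `1/m ≤ ε² / (72 L)` and is a sum of
  independent variables in `[0, M]` with `M = ε² / (324 L K)`, so the Chernoff bound at exponent
  `1/M` makes each bucket heavy with probability at most `exp (-K) = δ/m`.
* If all masses are at most `s`, then `E exp (l (∑ φ_i² - 1)) ≤ exp (3 l² s)` for `|l| s ≤ 1/4`. A
  bucket of mass `c` is subgaussian with variance `c`, and Gaussian linearization gives
  `E exp (φ_i² / (4c)) ≤ √2` (`lintegral_exp_sq_le_of_hasSubgaussianMGF`). As `e^u - 1 - u` scales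
  quadratically, this implies `E exp (l (φ_i² - c)) ≤ exp (3 l² c²)` for smaller exponents of either
  sign (`mgf_sq_le_of_hasSubgaussianMGF`), and the buckets multiply by independence.
* Markov's inequality at `l = ± 3 L / ε` bounds each tail by `δ²`, for a total of at most
  `δ + 2 δ² ≤ 2 δ` if `δ ≤ 1/2`; for larger `δ` there is nothing to show.

The estimates are made for the truncations to `j < N`, uniformly in `N`, and Fatou's lemma passes to
the limit (`measure_light_tail_le`). The series converge almost surely by martingale convergence
(`IsRademacherSeq.ae_exists_tendsto_sum`).
-/

namespace FeatureHashing

open Filter Topology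

/-! ### Exponential moments of squares of subgaussian variables -/

/-- The remainder `e^u - 1 - u` scales at least quadratically: each term `(a v)^n / n!` with `n ≥ 2` of
its series is at most `a²` times the term for `v`. -/
theorem exp_mul_sub_le {a v : ℝ} (ha : |a| ≤ 1) (hv : 0 ≤ v) :
    Real.exp (a * v) - 1 - a * v ≤ a ^ 2 * (Real.exp v - 1 - v) := by
  have key (x : ℝ) : HasSum (fun n : ℕ => x ^ (n + 2) / ((n + 2).factorial : ℝ))
      (Real.exp x - 1 - x) := by
    have h := NormedSpace.expSeries_div_hasSum_exp (𝔸 := ℝ) x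
    rw [← Real.exp_eq_exp_ℝ] at h
    have h2 := (hasSum_nat_add_iff' 2).2 h
    simpa [Finset.sum_range_succ, sub_sub] using h2
  refine hasSum_le (fun n => ?_) (key (a * v)) ((key v).mul_left (a ^ 2))
  have h1 : a ^ (n + 2) ≤ a ^ 2 := by
    rw [pow_add]
    have : a ^ n ≤ 1 := (le_abs_self _).trans (by rw [abs_pow]; exact pow_le_one₀ (abs_nonneg a) ha)
    nlinarith [sq_nonneg a]
  rw [mul_pow, ← mul_div_assoc]
  gcongr

theorem lintegral_exp_sq_div_four_gaussianReal :
    ∫⁻ g, ENNReal.ofReal (Real.exp (g ^ 2 / 4)) ∂(gaussianReal 0 1) = ENNReal.ofReal √2 := by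
  rw [gaussianReal_of_var_ne_zero _ one_ne_zero,
    lintegral_withDensity_eq_lintegral_mul _ (measurable_gaussianPDF 0 1) (by fun_prop)]
  have h (g : ℝ) : (gaussianPDF 0 1 * fun g => ENNReal.ofReal (Real.exp (g ^ 2 / 4))) g =
      ENNReal.ofReal ((√(2 * Real.pi))⁻¹ * Real.exp (-(1 / 4) * g ^ 2)) := by
    simp only [Pi.mul_apply, gaussianPDF, gaussianPDFReal]
    rw [← ENNReal.ofReal_mul (by positivity), mul_assoc, ← Real.exp_add]
    congr 3
    · simp
    · simp; ring
  simp_rw [h]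
  rw [← ofReal_integral_eq_lintegral_ofReal
    ((integrable_exp_neg_mul_sq (by norm_num)).const_mul _)
    (Eventually.of_forall fun g => by positivity), integral_const_mul, integral_gaussian]
  congr 1
  have e : √(Real.pi / (1 / 4)) = √(2 * Real.pi) * √2 := by
    rw [← Real.sqrt_mul (by positivity)]
    congr 1
    ring
  rw [e, inv_mul_cancel_left₀ (by positivity)]

section Subgaussian

variable {Ω : Type*} {mΩ : MeasurableSpace Ω} {μ : Measure Ω} {X : Ω → ℝ} {c : NNReal}

/-- Gaussian linearization: `exp (X² / (4c))` is the average of `exp (g X / √(2c))` over a standard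
Gaussian `g`. Exchanging the two integrals reduces a bound on the exponential moment of `X²` to the
bound on the moment generating function of `X`. -/
theorem lintegral_exp_sq_le_of_hasSubgaussianMGF [SFinite μ] (hX : HasSubgaussianMGF X c μ)
    (hm : Measurable X) (hc : 0 < c) :
    ∫⁻ ω, ENNReal.ofReal (Real.exp (X ω ^ 2 / (4 * c))) ∂μ ≤ ENNReal.ofReal √2 := by
  have hc' : (0 : ℝ) < c := hc
  set q : ℝ := √(2 * c) with hq
  have hq0 : 0 < q := by positivity
  have hq2 : q ^ 2 = 2 * c := Real.sq_sqrt (by positivity)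
  have h1 (ω : Ω) : ENNReal.ofReal (Real.exp (X ω ^ 2 / (4 * c))) =
      ∫⁻ g, ENNReal.ofReal (Real.exp (X ω / q * g)) ∂(gaussianReal 0 1) := by
    rw [← ofReal_integral_eq_lintegral_ofReal (integrable_exp_mul_gaussianReal _)
      (Eventually.of_forall fun g => (Real.exp_pos _).le)]
    have := congrFun (mgf_fun_id_gaussianReal (μ := 0) (v := 1)) (X ω / q)
    rw [mgf] at this
    rw [this, div_pow, hq2]
    congr 2
    simp
    field_simp
    ring
  simp_rw [h1]
  rw [lintegral_lintegral_swap (by fun_prop)]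
  rw [← lintegral_exp_sq_div_four_gaussianReal]
  refine lintegral_mono fun g => ?_
  have h2 (ω : Ω) : X ω / q * g = g / q * X ω := by ring
  simp_rw [h2]
  rw [← ofReal_integral_eq_lintegral_ofReal (hX.integrable_exp_mul _)
      (Eventually.of_forall fun g => (Real.exp_pos _).le)]
  refine ENNReal.ofReal_le_ofReal ((hX.mgf_le (g / q)).trans (Real.exp_le_exp.2 ?_))
  rw [div_pow, hq2]
  apply le_of_eq
  field_simp
  ring

/-- The centred square of a subgaussian variable whose variance equals its variance proxy has a
locally quadratic cumulant generating function. Both signs of `l` are allowed, so the bound serves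
for the upper and for the lower tail. -/
theorem mgf_sq_le_of_hasSubgaussianMGF [IsProbabilityMeasure μ] (hX : HasSubgaussianMGF X c μ)
    (hm : Measurable X) (hc : 0 < c) (hvar : ∫ ω, X ω ^ 2 ∂μ = c) {l : ℝ} (hl : |l| * c ≤ 1 / 4) :
    mgf (fun ω => X ω ^ 2) μ l ≤ Real.exp (l * c + 3 * l ^ 2 * c ^ 2) := by
  have hc' : (0 : ℝ) < c := hc
  have hlint := lintegral_exp_sq_le_of_hasSubgaussianMGF hX hm hc
  have hint : Integrable (fun ω => Real.exp (X ω ^ 2 / (4 * c))) μ := by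
    refine ⟨by fun_prop, ?_⟩
    rw [hasFiniteIntegral_iff_ofReal (Eventually.of_forall fun g => (Real.exp_pos _).le)]
    exact hlint.trans_lt ENNReal.ofReal_lt_top
  have hle : ∫ ω, Real.exp (X ω ^ 2 / (4 * c)) ∂μ ≤ √2 := by
    rw [← ENNReal.ofReal_le_ofReal_iff (by positivity), ofReal_integral_eq_lintegral_ofReal hint
      (Eventually.of_forall fun g => (Real.exp_pos _).le)]
    exact hlint
  have hsq : Integrable (fun ω => X ω ^ 2) μ := (hX.memLp 2).integrable_sq
  -- `a` is the ratio of `l` to the exponent `1 / (4c)` at which the moment is known.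
  set a : ℝ := 4 * c * l with ha
  have ha1 : |a| ≤ 1 := by
    rw [ha, abs_mul, abs_of_pos (by positivity)]; linarith
  have hpt (ω : Ω) : Real.exp (l * X ω ^ 2) ≤
      (1 + l * X ω ^ 2) + a ^ 2 * (Real.exp (X ω ^ 2 / (4 * c)) - (1 + (4 * c : ℝ)⁻¹ * X ω ^ 2)) := by
    have h := exp_mul_sub_le ha1 (v := X ω ^ 2 / (4 * c)) (by positivity)
    have e : a * (X ω ^ 2 / (4 * c)) = l * X ω ^ 2 := by rw [ha]; field_simp
    have e2 : X ω ^ 2 / (4 * c) = (4 * c : ℝ)⁻¹ * X ω ^ 2 := by field_simp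
    rw [e] at h
    rw [← e2]
    linarith
  have i1 (t : ℝ) : Integrable (fun ω => 1 + t * X ω ^ 2) μ :=
    (integrable_const _).add (hsq.const_mul _)
  have i2 : Integrable (fun ω => a ^ 2 *
      (Real.exp (X ω ^ 2 / (4 * c)) - (1 + (4 * c : ℝ)⁻¹ * X ω ^ 2))) μ :=
    (hint.sub (i1 _)).const_mul _
  have hl1 (t : ℝ) : ∫ ω, (1 + t * X ω ^ 2) ∂μ = 1 + t * c := by
    rw [integral_add (integrable_const _) (hsq.const_mul _), integral_const_mul, hvar]
    simp
  have hmain : mgf (fun ω => X ω ^ 2) μ l ≤ (1 + l * c) + a ^ 2 * (√2 - (1 + (4 * c : ℝ)⁻¹ * c)) := by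
    calc mgf (fun ω => X ω ^ 2) μ l ≤ ∫ ω, ((1 + l * X ω ^ 2) + a ^ 2 *
          (Real.exp (X ω ^ 2 / (4 * c)) - (1 + (4 * c : ℝ)⁻¹ * X ω ^ 2))) ∂μ :=
          integral_mono_of_nonneg (Eventually.of_forall fun g => (Real.exp_pos _).le)
            ((i1 l).add i2) (Eventually.of_forall hpt)
      _ = (1 + l * c) + a ^ 2 *
          ((∫ ω, Real.exp (X ω ^ 2 / (4 * c)) ∂μ) - (1 + (4 * c : ℝ)⁻¹ * c)) := by
          rw [integral_add (i1 l) i2, integral_const_mul, integral_sub hint (i1 _), hl1, hl1]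
      _ ≤ _ := by gcongr
  -- `16 (√2 - 5/4) ≤ 3` is where the constant `3` comes from.
  have hs2 : √2 ≤ 1.4375 := by
    rw [Real.sqrt_le_left (by norm_num)]; norm_num
  have hcc : (4 * c : ℝ)⁻¹ * c = 1 / 4 := by field_simp
  rw [hcc] at hmain
  refine hmain.trans ?_
  have h3 : a ^ 2 * (√2 - (1 + 1 / 4)) ≤ a ^ 2 * (3 / 16) := by
    gcongr; linarith
  have h4 : a ^ 2 * (3 / 16) = 3 * l ^ 2 * c ^ 2 := by rw [ha]; ring
  have := Real.add_one_le_exp (l * c + 3 * l ^ 2 * c ^ 2)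
  linarith

end Subgaussian

/-! ### Rademacher sums -/

/-- A sequence of independent symmetric random signs, as real random variables. The values are
`±1` everywhere, and not only almost everywhere; the symmetry is expressed by the mean being `0`. -/
structure IsRademacherSeq {Ω : Type*} {mΩ : MeasurableSpace Ω} (r : ℕ → Ω → ℝ)
    (μ : Measure Ω) : Prop where
  measurable : ∀ j, Measurable (r j)
  iIndepFun : iIndepFun r μ
  sq_eq_one : ∀ j ω, r j ω ^ 2 = 1
  integral_eq_zero : ∀ j, ∫ ω, r j ω ∂μ = 0

namespace IsRademacherSeq

variable {Ω : Type*} {mΩ : MeasurableSpace Ω} {μ : Measure Ω} {r : ℕ → Ω → ℝ}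

theorem abs_eq_one (hr : IsRademacherSeq r μ) (j : ℕ) (ω : Ω) : |r j ω| = 1 := by
  rw [← abs_one, ← sq_eq_sq_iff_abs_eq_abs, hr.sq_eq_one, one_pow]

theorem memLp (hr : IsRademacherSeq r μ) (j : ℕ) (p : ℝ≥0∞) : MemLp (r j) p μ := by
  have := hr.iIndepFun.isProbabilityMeasure
  exact MemLp.of_bound (hr.measurable j).aestronglyMeasurable 1
    (Eventually.of_forall fun ω => (hr.abs_eq_one j ω).le)

theorem measurable_sum (hr : IsRademacherSeq r μ) (S : Finset ℕ) (y : ℕ → ℝ) :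
    Measurable fun ω => ∑ j ∈ S, y j * r j ω :=
  Finset.measurable_fun_sum _ fun j _ => (hr.measurable j).const_mul _

/-- Hoeffding's lemma for signs: the variance proxy of a Rademacher sum is its variance. -/
theorem hasSubgaussianMGF_sum (hr : IsRademacherSeq r μ) (S : Finset ℕ) (y : ℕ → ℝ) :
    HasSubgaussianMGF (fun ω => ∑ j ∈ S, y j * r j ω) (∑ j ∈ S, (y j ^ 2).toNNReal) μ := by
  have := hr.iIndepFun.isProbabilityMeasure
  have hI : ProbabilityTheory.iIndepFun (fun j ω => y j * r j ω) μ :=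
    hr.iIndepFun.comp (fun j t => y j * t) fun j => by fun_prop
  refine HasSubgaussianMGF.sum_of_iIndepFun hI fun j _ => ?_
  have h := (hasSubgaussianMGF_of_mem_Icc_of_integral_eq_zero (a := -1) (b := 1)
    (hr.measurable j).aemeasurable
    (Eventually.of_forall fun ω => abs_le.1 (hr.abs_eq_one j ω).le)
    (hr.integral_eq_zero j)).const_mul (y j)
  convert h using 1
  ext
  norm_num [sq_nonneg]
  exact (mul_one _).symm

theorem integral_sum_sq (hr : IsRademacherSeq r μ) (S : Finset ℕ) (y : ℕ → ℝ) :
    ∫ ω, (∑ j ∈ S, y j * r j ω) ^ 2 ∂μ = ∑ j ∈ S, y j ^ 2 := by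
  have := hr.iIndepFun.isProbabilityMeasure
  have hL (i j : ℕ) : Integrable (fun ω => y i * r i ω * (y j * r j ω)) μ :=
    ((hr.memLp i 2).const_mul _).integrable_mul ((hr.memLp j 2).const_mul _)
  simp_rw [sq, Finset.sum_mul_sum]
  rw [integral_finsetSum _ fun i _ => integrable_finsetSum _ fun j _ => hL i j]
  refine Finset.sum_congr rfl fun i hi => ?_
  rw [integral_finsetSum _ fun j _ => hL i j, Finset.sum_eq_single_of_mem i hi]
  · have (ω : Ω) : y i * r i ω * (y i * r i ω) = y i * y i := by
      linear_combination y i ^ 2 * hr.sq_eq_one i ω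
    simp [this]
  · intro j _ hji
    have (ω : Ω) : y i * r i ω * (y j * r j ω) = y i * y j * (r i ω * r j ω) := by ring
    simp_rw [this]
    rw [integral_const_mul, (hr.iIndepFun.indepFun hji.symm).integral_fun_mul_eq_mul_integral
      (hr.measurable i).aestronglyMeasurable (hr.measurable j).aestronglyMeasurable,
      hr.integral_eq_zero]
    simp

theorem mgf_sum_sq_le (hr : IsRademacherSeq r μ) (S : Finset ℕ) (y : ℕ → ℝ) {l : ℝ}
    (hl : |l| * ∑ j ∈ S, y j ^ 2 ≤ 1 / 4) :
    mgf (fun ω => (∑ j ∈ S, y j * r j ω) ^ 2) μ l ≤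
      Real.exp (l * ∑ j ∈ S, y j ^ 2 + 3 * l ^ 2 * (∑ j ∈ S, y j ^ 2) ^ 2) := by
  have := hr.iIndepFun.isProbabilityMeasure
  set c : NNReal := ∑ j ∈ S, (y j ^ 2).toNNReal with hc
  have hcc : (c : ℝ) = ∑ j ∈ S, y j ^ 2 := by
    rw [hc, NNReal.coe_sum]
    exact Finset.sum_congr rfl fun j _ => Real.coe_toNNReal _ (sq_nonneg _)
  -- If `c = 0`, all coefficients on `S` vanish and the sum is identically `0`.
  rcases eq_or_lt_of_le (zero_le : 0 ≤ c) with h0 | h0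
  · rw [← h0, NNReal.coe_zero, eq_comm, Finset.sum_eq_zero_iff_of_nonneg
      fun j _ => sq_nonneg _] at hcc
    have hz (ω : Ω) : ∑ j ∈ S, y j * r j ω = 0 :=
      Finset.sum_eq_zero fun j hj => by rw [pow_eq_zero_iff two_ne_zero |>.1 (hcc j hj), zero_mul]
    simp only [hz, Finset.sum_eq_zero hcc]
    simp [mgf]
  · rw [← hcc]
    refine mgf_sq_le_of_hasSubgaussianMGF (hr.hasSubgaussianMGF_sum S y) (hr.measurable_sum S y) h0
      ?_ (by rwa [hcc])
    rw [hr.integral_sum_sq, ← hc, hcc]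

/-- Rademacher sums over disjoint sets of indices are independent, so the exponential moment of the
sum of their squares factors; the quadratic terms `l² (∑ y²)²` add up to at most `l² s ∑ ∑ y²`. -/
theorem mgf_sum_bucket_sq_le {ι : Type*} [DecidableEq ι] (hr : IsRademacherSeq r μ)
    (S : ι → Finset ℕ) (y : ℕ → ℝ) {l s : ℝ} (hl : |l| * s ≤ 1 / 4) (A : Finset ι)
    (hS : (A : Set ι).PairwiseDisjoint S)
    (hs : ∀ i ∈ A, ∑ j ∈ S i, y j ^ 2 ≤ s) :
    mgf (fun ω => ∑ i ∈ A, (∑ j ∈ S i, y j * r j ω) ^ 2) μ l ≤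
      Real.exp ((l + 3 * l ^ 2 * s) * ∑ i ∈ A, ∑ j ∈ S i, y j ^ 2) := by
  have := hr.iIndepFun.isProbabilityMeasure
  induction A using Finset.induction_on with
  | empty => simp [mgf]
  | insert a A ha ih =>
    have hdisj : Disjoint (S a) (A.biUnion S) := by
      rw [Finset.disjoint_biUnion_right]
      intro i hi
      exact hS (by simp) (by simp [hi]) (by rintro rfl; exact ha hi)
    have hind := hr.iIndepFun.indepFun_finset _ _ hdisj hr.measurable
    have hind' : IndepFun (fun ω => (∑ j ∈ S a, y j * r j ω) ^ 2)
        (fun ω => ∑ i ∈ A, (∑ j ∈ S i, y j * r j ω) ^ 2) μ := by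
      have h := hind.comp (φ := fun v : S a → ℝ => (∑ j : S a, y j * v j) ^ 2)
        (ψ := fun v : (A.biUnion S) → ℝ => ∑ i : A, (∑ j : S i, y j *
          v ⟨j, Finset.mem_biUnion.2 ⟨i, i.2, j.2⟩⟩) ^ 2) (by fun_prop) (by fun_prop)
      convert h using 1
      · ext ω
        simp only [Function.comp]
        rw [Finset.sum_coe_sort (S a) fun j => y j * r j ω]
      · ext ω
        simp only [Function.comp]
        rw [← Finset.sum_coe_sort A]
        refine Finset.sum_congr rfl fun i _ => ?_
        rw [Finset.sum_coe_sort (S i) fun j => y j * r j ω]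
    have hmul : mgf (fun ω => ∑ i ∈ insert a A, (∑ j ∈ S i, y j * r j ω) ^ 2) μ l =
        mgf (fun ω => (∑ j ∈ S a, y j * r j ω) ^ 2) μ l *
        mgf (fun ω => ∑ i ∈ A, (∑ j ∈ S i, y j * r j ω) ^ 2) μ l := by
      rw [← hind'.mgf_add]
      · congr 1
        ext ω
        simp [Finset.sum_insert ha]
      · have := hr.measurable_sum (S a) y
        exact Measurable.aestronglyMeasurable (by fun_prop)
      · have := fun i => hr.measurable_sum (S i) y
        exact Measurable.aestronglyMeasurable (by fun_prop)
    have hsa := hs a (by simp)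
    have hs0 : 0 ≤ ∑ j ∈ S a, y j ^ 2 := Finset.sum_nonneg fun j _ => sq_nonneg _
    have h1 := hr.mgf_sum_sq_le (S a) y (l := l)
      ((mul_le_mul_of_nonneg_left hsa (abs_nonneg l)).trans hl)
    have h2 := ih (hS.subset (by simp)) fun i hi => hs i (by simp [hi])
    rw [hmul, Finset.sum_insert ha, mul_add, Real.exp_add]
    refine mul_le_mul (h1.trans (Real.exp_le_exp.2 ?_)) h2 mgf_nonneg (Real.exp_pos _).le
    rw [add_mul, sq (∑ j ∈ S a, y j ^ 2)]
    nlinarith [mul_le_mul_of_nonneg_left hsa (mul_nonneg (sq_nonneg l) hs0)]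

/-- The bound of `mgf_sum_bucket_sq_le` as a lower Lebesgue integral, the form that Fatou's lemma
needs. -/
theorem lintegral_exp_sum_bucket_sq_le {ι : Type*} [DecidableEq ι] (hr : IsRademacherSeq r μ)
    (S : ι → Finset ℕ) (y : ℕ → ℝ) {l s : ℝ} (hl : |l| * s ≤ 1 / 4) (A : Finset ι)
    (hS : (A : Set ι).PairwiseDisjoint S)
    (hs : ∀ i ∈ A, ∑ j ∈ S i, y j ^ 2 ≤ s) :
    ∫⁻ ω, ENNReal.ofReal (Real.exp (l * ∑ i ∈ A, (∑ j ∈ S i, y j * r j ω) ^ 2)) ∂μ ≤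
      ENNReal.ofReal (Real.exp ((l + 3 * l ^ 2 * s) * ∑ i ∈ A, ∑ j ∈ S i, y j ^ 2)) := by
  have := hr.iIndepFun.isProbabilityMeasure
  have hm : Measurable fun ω => ∑ i ∈ A, (∑ j ∈ S i, y j * r j ω) ^ 2 := by
    have := fun i => hr.measurable_sum (S i) y
    fun_prop
  rw [← ofReal_integral_eq_lintegral_ofReal
    (integrable_exp_mul_of_mem_Icc (a := 0) (b := ∑ i ∈ A, (∑ j ∈ S i, |y j|) ^ 2) hm.aemeasurable
      (Eventually.of_forall fun ω => ⟨by positivity, ?_⟩))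
    (Eventually.of_forall fun ω => (Real.exp_pos _).le)]
  · exact ENNReal.ofReal_le_ofReal (hr.mgf_sum_bucket_sq_le S y hl A hS hs)
  · refine Finset.sum_le_sum fun i _ => ?_
    rw [← sq_abs]
    refine pow_le_pow_left₀ (abs_nonneg _) ((Finset.abs_sum_le_sum_abs _ _).trans ?_) 2
    exact Finset.sum_le_sum fun j _ => by rw [abs_mul, hr.abs_eq_one, mul_one]

/-- The partial sums of a square-summable Rademacher series form a martingale that is bounded in
`L²`, hence in `L¹`, so they converge almost surely. -/
theorem ae_exists_tendsto_sum (hr : IsRademacherSeq r μ) {y : ℕ → ℝ} {B : ℝ}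
    (hy : ∀ n, ∑ j ∈ Finset.range n, y j ^ 2 ≤ B) :
    ∀ᵐ ω ∂μ, ∃ c, Tendsto (fun n => ∑ j ∈ Finset.range n, y j * r j ω) atTop (𝓝 c) := by
  have := hr.iIndepFun.isProbabilityMeasure
  have hI : ProbabilityTheory.iIndepFun (fun j ω => y j * r j ω) μ :=
    hr.iIndepFun.comp (fun j t => y j * t) fun j => by fun_prop
  have hsm (j : ℕ) : StronglyMeasurable (fun ω => y j * r j ω) :=
    ((hr.measurable j).const_mul _).stronglyMeasurable
  set F := Filtration.natural (fun j ω => y j * r j ω) hsm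
  have hint (j : ℕ) : Integrable (fun ω => y j * r j ω) μ :=
    ((hr.memLp j 1).integrable le_rfl).const_mul _
  have hmart : Martingale (fun n ω => ∑ j ∈ Finset.range (n + 1), y j * r j ω) F μ := by
    refine martingale_of_condExp_sub_eq_zero_nat (fun n => ?_)
      (fun n => integrable_finsetSum _ fun j _ => hint j) fun n => ?_
    · refine Finset.stronglyMeasurable_fun_sum _ fun j hj => ?_
      exact (Filtration.stronglyAdapted_natural hsm j).mono
        (F.mono (Nat.lt_succ_iff.1 (Finset.mem_range.1 hj)))
    · have e : (fun ω => ∑ j ∈ Finset.range (n + 1 + 1), y j * r j ω) -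
          (fun ω => ∑ j ∈ Finset.range (n + 1), y j * r j ω) =
          fun ω => y (n + 1) * r (n + 1) ω := by
        ext ω
        simp [Finset.sum_range_succ _ (n + 1)]
      rw [e]
      refine (hI.condExp_natural_ae_eq_of_lt hsm (Nat.lt_succ_self n)).trans ?_
      rw [integral_const_mul, hr.integral_eq_zero, mul_zero]
      rfl
  have hbdd (n : ℕ) : eLpNorm (fun ω => ∑ j ∈ Finset.range (n + 1), y j * r j ω) 1 μ ≤
      ((1 + B).toNNReal : ℝ≥0∞) := by
    have hi : Integrable (fun ω => ∑ j ∈ Finset.range (n + 1), y j * r j ω) μ := hmart.integrable n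
    have hi2 : Integrable (fun ω => (∑ j ∈ Finset.range (n + 1), y j * r j ω) ^ 2) μ :=
      (memLp_finsetSum _ fun j _ => (hr.memLp j 2).const_mul (y j)).integrable_sq
    rw [eLpNorm_one_eq_lintegral_enorm, ← ofReal_integral_norm_eq_lintegral_enorm hi]
    refine ENNReal.ofReal_le_ofReal ?_
    calc ∫ ω, ‖∑ j ∈ Finset.range (n + 1), y j * r j ω‖ ∂μ
        ≤ ∫ ω, (1 + (∑ j ∈ Finset.range (n + 1), y j * r j ω) ^ 2) ∂μ := by
          refine integral_mono hi.norm ((integrable_const _).add hi2) fun ω => ?_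
          simp only [Real.norm_eq_abs]
          rw [← sq_abs]
          nlinarith [sq_nonneg (|∑ j ∈ Finset.range (n + 1), y j * r j ω| - 1),
            abs_nonneg (∑ j ∈ Finset.range (n + 1), y j * r j ω)]
      _ ≤ 1 + B := by
          rw [integral_add (integrable_const _) hi2, hr.integral_sum_sq]
          simpa using hy (n + 1)
  filter_upwards [hmart.submartingale.exists_ae_tendsto_of_bdd hbdd] with ω ⟨c, hc⟩
  exact ⟨c, (tendsto_add_atTop_iff_nat 1).1 hc⟩

end IsRademacherSeq


/-! ### The coordinates of the hash functions -/

instance : MeasurableSingletonClass ℤˣ where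
  measurableSet_singleton u := by
    have h : ({u} : Set ℤˣ) = Units.val ⁻¹' {(u : ℤ)} := by
      ext v
      simp [Units.ext_iff]
    rw [h]
    exact (comap_measurable Units.val) (measurableSet_singleton _)

theorem isRademacherSeq_signs :
    IsRademacherSeq (fun j (ξ : ℕ → ℤˣ) => ((ξ j : ℤ) : ℝ))
      (Measure.infinitePi fun _ : ℕ => uniformOn (Set.univ : Set ℤˣ)) where
  measurable j := (measurable_of_countable fun u : ℤˣ => ((u : ℤ) : ℝ)).comp (measurable_pi_apply j)
  iIndepFun := iIndepFun_infinitePi (X := fun _ (u : ℤˣ) => ((u : ℤ) : ℝ))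
    fun _ => measurable_of_countable _
  sq_eq_one j ξ := by
    rcases Int.units_eq_one_or (ξ j) with h | h <;> simp [h]
  integral_eq_zero j := by
    have h := (measurePreserving_eval_infinitePi
      (fun _ : ℕ => uniformOn (Set.univ : Set ℤˣ)) j).map_eq
    have h2 := integral_map (μ := Measure.infinitePi fun _ : ℕ => uniformOn (Set.univ : Set ℤˣ))
      (φ := Function.eval j) (measurable_pi_apply j).aemeasurable
      (f := fun u : ℤˣ => ((u : ℤ) : ℝ)) (measurable_of_countable _).aestronglyMeasurable
    rw [h] at h2
    simp only [Function.eval] at h2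
    rw [← h2, integral_fintype .of_finite]
    simp [UnitsInt.univ, Measure.real, uniformOn_univ]

theorem integral_ite_eval (m : ℕ) [NeZero m] (i : Fin m) (j : ℕ) (a b : ℝ) :
    ∫ h, (if h j = i then a else b)
      ∂(Measure.infinitePi fun _ : ℕ => uniformOn (Set.univ : Set (Fin m))) =
      b + (a - b) / m := by
  have h := (measurePreserving_eval_infinitePi
      (fun _ : ℕ => uniformOn (Set.univ : Set (Fin m))) j).map_eq
  have h2 := integral_map
    (μ := Measure.infinitePi fun _ : ℕ => uniformOn (Set.univ : Set (Fin m)))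
    (φ := Function.eval j) (measurable_pi_apply j).aemeasurable
    (f := fun u : Fin m => if u = i then a else b) (measurable_of_countable _).aestronglyMeasurable
  rw [h] at h2
  simp only [Function.eval] at h2
  have hm : (m : ℝ) ≠ 0 := NeZero.ne _
  rw [← h2, integral_fintype .of_finite]
  have e (u : Fin m) : (if u = i then a else b) = b + if u = i then a - b else 0 := by
    split_ifs <;> ring
  simp only [e, smul_add, Finset.sum_add_distrib, smul_ite, smul_zero, Finset.sum_ite_eq',
    Finset.mem_univ, if_true]
  simp [Measure.real, uniformOn_univ]
  field_simp

/-! ### Bucket masses -/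

/-- Chernoff bound, with exponent `1 / M`, for the mass that a uniform hash function sends to the
bucket `i`. -/
theorem measure_lt_bucketMass_le (m : ℕ) [NeZero m] (i : Fin m) {w : ℕ → ℝ} {M s : ℝ} (hM : 0 < M)
    (hw0 : ∀ j, 0 ≤ w j) (hwM : ∀ j, w j ≤ M) (N : ℕ) (hw1 : ∑ j ∈ Finset.range N, w j ≤ 1) :
    (Measure.infinitePi fun _ : ℕ => uniformOn (Set.univ : Set (Fin m)))
      {h | s < ∑ j ∈ Finset.range N, if h j = i then w j else 0} ≤
      ENNReal.ofReal (Real.exp (M⁻¹ * ((Real.exp 1 - 1) / m - s))) := by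
  set P := Measure.infinitePi fun _ : ℕ => uniformOn (Set.univ : Set (Fin m)) with hP
  have hm : (0 : ℝ) < m := Nat.cast_pos.2 (NeZero.pos m)
  have hmeas (j : ℕ) : Measurable fun h : ℕ → Fin m => if h j = i then w j else 0 :=
    (measurable_of_countable fun u : Fin m => if u = i then w j else 0).comp (measurable_pi_apply j)
  have hI : iIndepFun (fun j (h : ℕ → Fin m) => if h j = i then w j else 0) P :=
    iIndepFun_infinitePi (X := fun j (u : Fin m) => if u = i then w j else 0)
      fun _ => measurable_of_countable _
  have hE : 0 ≤ Real.exp 1 - 1 := by linarith [Real.add_one_le_exp 1]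
  have hmgf (j : ℕ) : mgf (fun h : ℕ → Fin m => if h j = i then w j else 0) P M⁻¹ ≤
      Real.exp (M⁻¹ * ((Real.exp 1 - 1) / m) * w j) := by
    have e (h : ℕ → Fin m) : Real.exp (M⁻¹ * if h j = i then w j else 0) =
        if h j = i then Real.exp (M⁻¹ * w j) else 1 := by split_ifs <;> simp
    simp only [mgf, e]
    rw [integral_ite_eval]
    have ha : |M⁻¹ * w j| ≤ 1 := by
      rw [abs_of_nonneg (mul_nonneg (by positivity) (hw0 j)), inv_mul_le_iff₀ hM, mul_one]
      exact hwM j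
    -- Convexity of `exp` on `[0, 1]`.
    have hconv : Real.exp (M⁻¹ * w j) - 1 ≤ (Real.exp 1 - 1) * (M⁻¹ * w j) := by
      have h1 := exp_mul_sub_le ha zero_le_one
      rw [mul_one] at h1
      have h0 : 0 ≤ M⁻¹ * w j := mul_nonneg (by positivity) (hw0 j)
      have h2 := le_of_abs_le ha
      nlinarith [mul_nonneg (mul_nonneg h0 (sub_nonneg.2 h2))
        (by linarith [Real.add_one_le_exp 1] : 0 ≤ Real.exp 1 - 1 - 1)]
    have h3 : (Real.exp (M⁻¹ * w j) - 1) / m ≤ M⁻¹ * ((Real.exp 1 - 1) / m) * w j := by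
      rw [div_le_iff₀ hm]
      refine hconv.trans (le_of_eq ?_)
      field_simp
    linarith [Real.add_one_le_exp (M⁻¹ * ((Real.exp 1 - 1) / m) * w j)]
  set X : (ℕ → Fin m) → ℝ := fun h => ∑ j ∈ Finset.range N, if h j = i then w j else 0 with hX
  have hXm : Measurable X := Finset.measurable_fun_sum _ fun j _ => hmeas j
  have hXint : Integrable (fun h => Real.exp (M⁻¹ * X h)) P := by
    refine integrable_exp_mul_of_mem_Icc (a := 0) (b := 1) hXm.aemeasurable
      (Eventually.of_forall fun h => ⟨Finset.sum_nonneg fun j _ => ?_,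
        (Finset.sum_le_sum fun j _ => ?_).trans hw1⟩)
    · split_ifs
      exacts [hw0 j, le_rfl]
    · split_ifs
      exacts [le_rfl, hw0 j]
  have hmgfX : mgf X P M⁻¹ ≤ Real.exp (M⁻¹ * ((Real.exp 1 - 1) / m)) := by
    have := hI.mgf_sum (t := M⁻¹) hmeas (Finset.range N)
    have e : X = ∑ j ∈ Finset.range N, fun h : ℕ → Fin m => if h j = i then w j else 0 := by
      ext h
      simp [hX]
    rw [e, this]
    refine (Finset.prod_le_prod (fun _ _ => mgf_nonneg) fun j _ => hmgf j).trans ?_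
    rw [← Real.exp_sum, ← Finset.mul_sum, Real.exp_le_exp]
    exact mul_le_of_le_one_right (by positivity) hw1
  have hch := measure_ge_le_exp_mul_mgf (μ := P) (X := X) s (inv_nonneg.2 hM.le) hXint
  calc P {h | s < X h} ≤ P {h | s ≤ X h} := measure_mono fun h (hh : s < X h) => show s ≤ X h from hh.le
    _ = ENNReal.ofReal (P.real {h | s ≤ X h}) := by simp
    _ ≤ _ := by
      refine ENNReal.ofReal_le_ofReal (hch.trans ?_)
      rw [mul_sub, sub_eq_neg_add, Real.exp_add, ← neg_mul]
      gcongr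

/-- The hash functions all of whose buckets have mass at most `s`. The mass of a bucket is bounded
through the finite sums over `j < N`, which avoids infinite sums in the measurability proof. -/
def lightHashes (m : ℕ) (x : L2) (s : ℝ) : Set (ℕ → Fin m) :=
  {h | ∀ i N, ∑ j ∈ Finset.range N with h j = i, x j ^ 2 ≤ s}

theorem measurable_bucketMass {m : ℕ} (x : L2) (i : Fin m) (N : ℕ) :
    Measurable fun h : ℕ → Fin m => ∑ j ∈ Finset.range N with h j = i, x j ^ 2 := by
  simp_rw [Finset.sum_filter]
  exact Finset.measurable_fun_sum _ fun j _ =>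
    (measurable_of_countable fun u : Fin m => if u = i then x j ^ 2 else 0).comp
      (measurable_pi_apply j)

theorem measurableSet_lightHashes (m : ℕ) (x : L2) (s : ℝ) :
    MeasurableSet (lightHashes m x s) := by
  simp only [lightHashes, Set.ofPred_forall]
  exact MeasurableSet.iInter fun i => MeasurableSet.iInter fun N =>
    measurableSet_le (measurable_bucketMass x i N) measurable_const

theorem hasSum_sq (x : L2) : HasSum (fun j => x j ^ 2) (‖x‖ ^ 2) := by
  simpa using lp.hasSum_norm (p := 2) (by norm_num) x

theorem sum_range_sq_le (x : L2) (N : ℕ) : ∑ j ∈ Finset.range N, x j ^ 2 ≤ ‖x‖ ^ 2 :=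
  sum_le_hasSum _ (fun _ _ => sq_nonneg _) (hasSum_sq x)

/-- Union bound over the buckets. The masses of the initial segments increase with `N`, so a bound
that is uniform in `N` carries over to the union over all `N`. -/
theorem measure_compl_lightHashes_le (m : ℕ) [NeZero m] {x : L2} (hx : ‖x‖ = 1) {M s : ℝ}
    (hM : 0 < M) (hxM : ∀ j, x j ^ 2 ≤ M) :
    (Measure.infinitePi fun _ : ℕ => uniformOn (Set.univ : Set (Fin m))) (lightHashes m x s)ᶜ ≤
      m * ENNReal.ofReal (Real.exp (M⁻¹ * ((Real.exp 1 - 1) / m - s))) := by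
  set P := Measure.infinitePi fun _ : ℕ => uniformOn (Set.univ : Set (Fin m)) with hP
  have e : (lightHashes m x s)ᶜ =
      ⋃ i : Fin m, ⋃ N : ℕ, {h | s < ∑ j ∈ Finset.range N with h j = i, x j ^ 2} := by
    ext h
    simp [lightHashes]
  rw [e]
  refine (measure_iUnion_fintype_le _ _).trans ?_
  have hi (i : Fin m) : P (⋃ N : ℕ, {h | s < ∑ j ∈ Finset.range N with h j = i, x j ^ 2}) ≤
      ENNReal.ofReal (Real.exp (M⁻¹ * ((Real.exp 1 - 1) / m - s))) := by
    rw [Monotone.measure_iUnion]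
    · refine iSup_le fun N => ?_
      have hle := sum_range_sq_le x N
      rw [hx, one_pow] at hle
      have := measure_lt_bucketMass_le m i (s := s) hM (fun j => sq_nonneg (x j)) hxM N hle
      simpa only [Finset.sum_filter] using this
    · intro N N' hN h hh
      refine lt_of_lt_of_le (Set.mem_ofPred.1 hh) (Finset.sum_le_sum_of_subset_of_nonneg ?_
        fun _ _ _ => sq_nonneg _)
      exact Finset.filter_subset_filter _ (Finset.range_mono hN)
  refine (Finset.sum_le_sum fun i _ => hi i).trans ?_
  simp

/-! ### The hashed squared norm -/

theorem sum_bucketTerm {m : ℕ} (h : ℕ → Fin m) (ξ : ℕ → ℤˣ) (x : L2) (i : Fin m) (N : ℕ) :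
    ∑ j ∈ Finset.range N, bucketTerm h ξ x i j =
      ∑ j ∈ Finset.range N with h j = i, x j * ((ξ j : ℤ) : ℝ) := by
  simp only [bucketTerm, Finset.sum_filter, mul_comm]

theorem measurable_bucketTerm {m : ℕ} (x : L2) (i : Fin m) (j : ℕ) :
    Measurable fun p : (ℕ → Fin m) × (ℕ → ℤˣ) => bucketTerm p.1 p.2 x i j := by
  have hcoord : Measurable fun p : (ℕ → Fin m) × (ℕ → ℤˣ) => (p.1 j, p.2 j) := by fun_prop
  exact (measurable_of_countable
    fun q : Fin m × ℤˣ => if q.1 = i then ((q.2 : ℤ) : ℝ) * x j else 0).comp hcoord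

theorem hashConverges_iff {m : ℕ} (h : ℕ → Fin m) (ξ : ℕ → ℤˣ) (x : L2) :
    HashConverges h ξ x ↔ ∀ i, ∃ c, Tendsto
      (fun N => ∑ j ∈ Finset.range N, bucketTerm h ξ x i j) atTop (𝓝 c) := by
  simp only [HashConverges, Summable, HasSum, SummationFilter.conditional_filter_eq_map_range,
    tendsto_map'_iff, Function.comp_def]

theorem tendsto_sum_sq_hashNormSq {m : ℕ} {h : ℕ → Fin m} {ξ : ℕ → ℤˣ} {x : L2}
    (hc : HashConverges h ξ x) :
    Tendsto (fun N => ∑ i, (∑ j ∈ Finset.range N, bucketTerm h ξ x i j) ^ 2) atTop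
      (𝓝 (hashNormSq h ξ x)) := by
  have e : hashNormSq h ξ x =
      ∑ i, (∑'[SummationFilter.conditional ℕ] j : ℕ, bucketTerm h ξ x i j) ^ 2 := by
    rw [hashNormSq, hashInner, real_inner_self_eq_norm_sq, EuclideanSpace.norm_sq_eq]
    simp [hashMap]
  rw [e]
  refine tendsto_finsetSum _ fun i _ => ?_
  have := (hc i).hasSum
  simp only [HasSum, SummationFilter.conditional_filter_eq_map_range,
    tendsto_map'_iff, Function.comp_def] at this
  exact this.pow 2

/-- For a fixed `h` every bucket is a square-summable Rademacher series in `ξ`; Fubini's theorem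
transfers the almost sure convergence to the product measure. -/
theorem ae_hashConverges (m : ℕ) [NeZero m] (x : L2) :
    ∀ᵐ p ∂(hashLaw m), HashConverges p.1 p.2 x := by
  have hms : MeasurableSet {p : (ℕ → Fin m) × (ℕ → ℤˣ) | HashConverges p.1 p.2 x} := by
    simp only [hashConverges_iff, Set.ofPred_forall]
    exact MeasurableSet.iInter fun i => measurableSet_exists_tendsto fun N =>
      Finset.measurable_fun_sum _ fun j _ => measurable_bucketTerm x i j
  rw [hashLaw, Measure.ae_prod_iff_ae_ae hms]
  refine Eventually.of_forall fun h => ?_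
  simp only [hashConverges_iff]
  rw [ae_all_iff]
  intro i
  have key := isRademacherSeq_signs.ae_exists_tendsto_sum
    (y := fun j => if h j = i then x j else 0) (B := ‖x‖ ^ 2) fun n =>
      (Finset.sum_le_sum fun j _ => by split_ifs; exacts [le_rfl, by simpa using sq_nonneg (x j)]).trans
        (sum_range_sq_le x n)
  filter_upwards [key] with ξ hξ
  convert hξ using 7 with c N j
  simp [bucketTerm, mul_comm]

/-- For a fixed hash function with light buckets, the exponential moment of the truncated and centred
hashed squared norm, with a bound that does not depend on the truncation. -/
theorem lintegral_exp_truncated_le {m : ℕ} {x : L2} (hx : ‖x‖ = 1) {h : ℕ → Fin m} {l s : ℝ}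
    (hl : |l| * s ≤ 1 / 4) (hs : 0 ≤ s) (hh : h ∈ lightHashes m x s) (N : ℕ) :
    ∫⁻ ξ, ENNReal.ofReal (Real.exp (l * (∑ i, (∑ j ∈ Finset.range N, bucketTerm h ξ x i j) ^ 2 -
        ∑ j ∈ Finset.range N, x j ^ 2)))
      ∂(Measure.infinitePi fun _ : ℕ => uniformOn (Set.univ : Set ℤˣ)) ≤
      ENNReal.ofReal (Real.exp (3 * l ^ 2 * s)) := by
  set T := ∑ j ∈ Finset.range N, x j ^ 2 with hT
  have hT1 : T ≤ 1 := by simpa [hx] using sum_range_sq_le x N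
  have hmass : ∑ i : Fin m, ∑ j ∈ Finset.range N with h j = i, x j ^ 2 = T :=
    Finset.sum_fiberwise _ _ _
  have key := isRademacherSeq_signs.lintegral_exp_sum_bucket_sq_le
    (fun i : Fin m => (Finset.range N).filter (h · = i)) (fun j => x j) hl Finset.univ
    (fun i _ i' _ hne => Finset.disjoint_filter.2 fun j _ h1 h2 => hne (h1.symm.trans h2))
    (fun i _ => hh i N)
  rw [hmass] at key
  have e (ξ : ℕ → ℤˣ) : ENNReal.ofReal (Real.exp (l * (∑ i, (∑ j ∈ Finset.range N,
      bucketTerm h ξ x i j) ^ 2 - T))) = ENNReal.ofReal (Real.exp (-(l * T))) *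
      ENNReal.ofReal (Real.exp (l * ∑ i, (∑ j ∈ Finset.range N with h j = i,
        x j * ((ξ j : ℤ) : ℝ)) ^ 2)) := by
    rw [← ENNReal.ofReal_mul (Real.exp_pos _).le, ← Real.exp_add]
    simp only [sum_bucketTerm]
    congr 2
    ring
  simp_rw [e]
  rw [lintegral_const_mul' _ _ ENNReal.ofReal_ne_top]
  refine (mul_le_mul_right key _).trans ?_
  rw [← ENNReal.ofReal_mul (Real.exp_pos _).le, ← Real.exp_add]
  refine ENNReal.ofReal_le_ofReal (Real.exp_le_exp.2 ?_)
  nlinarith [mul_le_mul_of_nonneg_left hT1 (mul_nonneg (sq_nonneg l) hs)]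

/-- Tail bound on the event that the buckets are light. Fatou's lemma along the truncations yields the
exponential moment of the limit, and Markov's inequality is applied to the lower limit, which is
measurable by construction. -/
theorem measure_light_tail_le (m : ℕ) [NeZero m] {x : L2} (hx : ‖x‖ = 1) {l s : ℝ} (t : ℝ)
    (hl : |l| * s ≤ 1 / 4) (hs : 0 ≤ s) :
    hashLaw m {p | p.1 ∈ lightHashes m x s ∧ HashConverges p.1 p.2 x ∧
      t ≤ l * (hashNormSq p.1 p.2 x - 1)} ≤ ENNReal.ofReal (Real.exp (3 * l ^ 2 * s - t)) := by
  set Y : ℕ → (ℕ → Fin m) × (ℕ → ℤˣ) → ℝ≥0∞ := fun N p =>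
    (Prod.fst ⁻¹' lightHashes m x s).indicator (fun p => ENNReal.ofReal (Real.exp (l *
      (∑ i, (∑ j ∈ Finset.range N, bucketTerm p.1 p.2 x i j) ^ 2 -
        ∑ j ∈ Finset.range N, x j ^ 2)))) p with hY
  have hYm (N : ℕ) : Measurable (Y N) := by
    refine Measurable.indicator ?_ (measurable_fst (measurableSet_lightHashes m x s))
    have := fun i j => measurable_bucketTerm (m := m) x i j
    fun_prop
  have hYint (N : ℕ) : ∫⁻ p, Y N p ∂(hashLaw m) ≤ ENNReal.ofReal (Real.exp (3 * l ^ 2 * s)) := by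
    rw [hashLaw, lintegral_prod _ (hYm N).aemeasurable]
    refine (lintegral_mono (g := fun _ => ENNReal.ofReal (Real.exp (3 * l ^ 2 * s)))
      fun h => ?_).trans (by simp)
    by_cases hh : h ∈ lightHashes m x s
    · refine le_trans (le_of_eq ?_) (lintegral_exp_truncated_le hx hl hs hh N)
      refine lintegral_congr fun ξ => ?_
      exact Set.indicator_of_mem (s := Prod.fst ⁻¹' lightHashes m x s) (a := (h, ξ)) hh _
    · have (ξ : ℕ → ℤˣ) : Y N (h, ξ) = 0 :=
        Set.indicator_of_notMem (s := Prod.fst ⁻¹' lightHashes m x s) (a := (h, ξ)) hh _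
      simp [this]
  have hFatou : ∫⁻ p, liminf (fun N => Y N p) atTop ∂(hashLaw m) ≤
      ENNReal.ofReal (Real.exp (3 * l ^ 2 * s)) :=
    (lintegral_liminf_le hYm).trans
      ((liminf_le_liminf (Eventually.of_forall hYint)).trans (by simp))
  have hsub : {p : (ℕ → Fin m) × (ℕ → ℤˣ) | p.1 ∈ lightHashes m x s ∧ HashConverges p.1 p.2 x ∧
      t ≤ l * (hashNormSq p.1 p.2 x - 1)} ⊆
      {p | ENNReal.ofReal (Real.exp t) ≤ liminf (fun N => Y N p) atTop} := by
    rintro p ⟨hp, hc, ht⟩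
    have hlim : Tendsto (fun N => Y N p) atTop
        (𝓝 (ENNReal.ofReal (Real.exp (l * (hashNormSq p.1 p.2 x - 1))))) := by
      have e (N : ℕ) : Y N p = ENNReal.ofReal (Real.exp (l *
          (∑ i, (∑ j ∈ Finset.range N, bucketTerm p.1 p.2 x i j) ^ 2 -
            ∑ j ∈ Finset.range N, x j ^ 2))) :=
        Set.indicator_of_mem (s := Prod.fst ⁻¹' lightHashes m x s) hp _
      simp only [e]
      have hT := (hasSum_sq x).tendsto_sum_nat
      rw [hx, one_pow] at hT
      exact ENNReal.tendsto_ofReal ((Real.continuous_exp.tendsto _).comp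
        (((tendsto_sum_sq_hashNormSq hc).sub hT).const_mul l))
    rw [Set.mem_ofPred_eq, hlim.liminf_eq]
    exact ENNReal.ofReal_le_ofReal (Real.exp_le_exp.2 ht)
  refine (measure_mono hsub).trans ((meas_ge_le_lintegral_div
    (Measurable.liminf hYm).aemeasurable (by simp [Real.exp_pos]) ENNReal.ofReal_ne_top).trans ?_)
  rw [Real.exp_sub, ENNReal.ofReal_div_of_pos (Real.exp_pos _)]
  gcongr

theorem abs_le_supNorm (x : L2) (j : ℕ) : |x j| ≤ supNorm x :=
  le_ciSup (f := fun j => |x j|) ⟨‖x‖, by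
    rintro _ ⟨k, rfl⟩
    exact lp.norm_apply_le_norm two_ne_zero x k⟩ j

end FeatureHashing

theorem mainTheorem1 (m : ℕ) (ε δ : ℝ) (hε0 : 0 < ε) (hε1 : ε < 1) (hδ0 : 0 < δ) (hδ1 : δ < 1)
    (x : FeatureHashing.L2) (hx : ‖x‖ = 1)
    (hm : 72 * Real.log (1 / δ) / ε ^ 2 ≤ (m : ℝ))
    (hsup : FeatureHashing.supNorm x ≤
      ε / (18 * Real.sqrt (Real.log (1 / δ) * Real.log ((m : ℝ) / δ)))) :
    (∀ᵐ p ∂(FeatureHashing.hashLaw m), FeatureHashing.HashConverges p.1 p.2 x) ∧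
    FeatureHashing.hashLaw m {p | ε ≤ |FeatureHashing.hashNormSq p.1 p.2 x - 1|} ≤
      ENNReal.ofReal (2 * δ) := by
  set L := Real.log (1 / δ) with hL
  set K := Real.log ((m : ℝ) / δ) with hK
  have hL0 : 0 < L := Real.log_pos (by rw [lt_div_iff₀ hδ0]; linarith)
  have hm0 : (0 : ℝ) < m := lt_of_lt_of_le (by positivity) hm
  have hm1 : (1 : ℝ) ≤ m := by exact_mod_cast Nat.cast_pos.1 hm0
  have : NeZero m := ⟨by rintro rfl; simp at hm0⟩
  have hK0 : 0 < K := Real.log_pos (by rw [lt_div_iff₀ hδ0]; linarith)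
  have hconv := FeatureHashing.ae_hashConverges m x
  refine ⟨hconv, ?_⟩
  have hprob : IsProbabilityMeasure (FeatureHashing.hashLaw m) := by
    unfold FeatureHashing.hashLaw
    infer_instance
  rcases le_or_gt (1 / 2) δ with hδ2 | hδ2
  · exact prob_le_one.trans (ENNReal.one_le_ofReal.2 (by linarith))
  -- `M` is the bound on `x j ^ 2` given by `hsup`, and `s` is the mass allowed in a bucket.
  set M := ε ^ 2 / (324 * L * K) with hM
  set s := ε ^ 2 / (36 * L) with hs
  have hM0 : 0 < M := by positivity
  have hs0 : 0 < s := by positivity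
  have hxM (j : ℕ) : x j ^ 2 ≤ M := by
    have h1 := (FeatureHashing.abs_le_supNorm x j).trans hsup
    have h2 := pow_le_pow_left₀ (abs_nonneg _) h1 2
    rw [sq_abs, div_pow, mul_pow, Real.sq_sqrt (by positivity)] at h2
    refine h2.trans (le_of_eq ?_)
    rw [hM]
    congr 1
    ring
  have hexpK : Real.exp (-K) = δ / m := by
    rw [Real.exp_neg, hK, Real.exp_log (by positivity), inv_div]
  have hexpL : Real.exp (-L) = δ := by
    rw [Real.exp_neg, hL, Real.exp_log (by positivity), one_div, inv_inv]
  have hheavy : (Measure.infinitePi fun _ : ℕ => uniformOn (Set.univ : Set (Fin m)))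
      (FeatureHashing.lightHashes m x s)ᶜ ≤ ENNReal.ofReal δ := by
    refine (FeatureHashing.measure_compl_lightHashes_le m hx hM0 hxM).trans ?_
    -- Since `1 / m ≤ ε² / (72 L)`, this amounts to `(e - 1) / 72 + 1 / 324 ≤ 1 / 36`, that is,
    -- `e ≤ 25 / 9`.
    have hexp : M⁻¹ * ((Real.exp 1 - 1) / m - s) ≤ -K := by
      rw [inv_mul_le_iff₀ hM0]
      have h1 : 1 / (m : ℝ) ≤ ε ^ 2 / (72 * L) := by
        rw [div_le_div_iff₀ hm0 (by positivity), one_mul]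
        rw [div_le_iff₀ (by positivity)] at hm
        linarith
      have h2 : (Real.exp 1 - 1) / m ≤ 1.75 * (ε ^ 2 / (72 * L)) := by
        rw [div_eq_mul_one_div]
        have := Real.exp_one_lt_d9
        gcongr
        linarith
      have h3 : M * -K = -(ε ^ 2 / L) / 324 := by rw [hM]; field_simp
      have h4 : s = (ε ^ 2 / L) / 36 := by rw [hs]; field_simp
      have h5 : ε ^ 2 / (72 * L) = (ε ^ 2 / L) / 72 := by field_simp
      have h6 : 0 < ε ^ 2 / L := by positivity
      rw [h3, h4]
      rw [h5] at h2
      linarith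
    calc (m : ℝ≥0∞) * ENNReal.ofReal (Real.exp (M⁻¹ * ((Real.exp 1 - 1) / m - s)))
        ≤ (m : ℝ≥0∞) * ENNReal.ofReal (δ / m) := by
          rw [← hexpK]
          gcongr
      _ = ENNReal.ofReal δ := by
          rw [← ENNReal.ofReal_natCast, ← ENNReal.ofReal_mul hm0.le, mul_div_cancel₀ _ hm0.ne']
  -- With this `l` the exponent is `3 l² s - l ε = (3 / 4 - 3) L ≤ -2 L`, so each tail is at most
  -- `δ²`, and `2 δ² ≤ δ`.
  set l := 3 * L / ε with hl
  have hl0 : 0 < l := by positivity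
  have hls : |l| * s ≤ 1 / 4 := by
    have : |l| * s = ε / 12 := by
      rw [abs_of_pos hl0, hl, hs]
      field_simp
      norm_num
    linarith
  have hlε : l * ε = 3 * L := by rw [hl]; field_simp
  have htail : Real.exp (3 * l ^ 2 * s - 3 * L) ≤ δ ^ 2 := by
    have h1 : 3 * l ^ 2 * s = 3 / 4 * L := by
      rw [hl, hs]
      field_simp
      norm_num
    rw [h1, ← hexpL, ← Real.exp_nat_mul, Real.exp_le_exp]
    push_cast
    linarith
  have hup := FeatureHashing.measure_light_tail_le m hx (3 * L) hls hs0.le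
  have hlow := FeatureHashing.measure_light_tail_le m hx (l := -l) (3 * L) (by rwa [abs_neg]) hs0.le
  rw [neg_sq] at hlow
  have hheavy' : FeatureHashing.hashLaw m ((FeatureHashing.lightHashes m x s)ᶜ ×ˢ Set.univ) ≤
      ENNReal.ofReal δ := by
    rw [FeatureHashing.hashLaw, Measure.prod_prod]
    simpa using hheavy
  have hcover : {p | ε ≤ |FeatureHashing.hashNormSq p.1 p.2 x - 1|} ≤ᵐ[FeatureHashing.hashLaw m]
      ((FeatureHashing.lightHashes m x s)ᶜ ×ˢ Set.univ ∪
        ({p | p.1 ∈ FeatureHashing.lightHashes m x s ∧ FeatureHashing.HashConverges p.1 p.2 x ∧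
          3 * L ≤ l * (FeatureHashing.hashNormSq p.1 p.2 x - 1)} ∪
        {p | p.1 ∈ FeatureHashing.lightHashes m x s ∧ FeatureHashing.HashConverges p.1 p.2 x ∧
          3 * L ≤ -l * (FeatureHashing.hashNormSq p.1 p.2 x - 1)}) : Set _) := by
    filter_upwards [hconv] with p hc hp
    by_cases hlight : p.1 ∈ FeatureHashing.lightHashes m x s
    · right
      rcases le_abs.1 (show ε ≤ |FeatureHashing.hashNormSq p.1 p.2 x - 1| from hp) with h | h
      · exact Or.inl ⟨hlight, hc, by rw [← hlε]; gcongr⟩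
      · refine Or.inr ⟨hlight, hc, ?_⟩
        rw [← hlε, neg_mul, ← mul_neg]
        gcongr
    · exact Or.inl ⟨hlight, trivial⟩
  calc FeatureHashing.hashLaw m {p | ε ≤ |FeatureHashing.hashNormSq p.1 p.2 x - 1|}
      ≤ ENNReal.ofReal δ + (ENNReal.ofReal (δ ^ 2) + ENNReal.ofReal (δ ^ 2)) := by
        refine (measure_mono_ae hcover).trans ((measure_union_le _ _).trans ?_)
        refine add_le_add hheavy' ((measure_union_le _ _).trans (add_le_add ?_ ?_))
        · exact hup.trans (ENNReal.ofReal_le_ofReal htail)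
        · exact hlow.trans (ENNReal.ofReal_le_ofReal htail)
    _ ≤ ENNReal.ofReal (2 * δ) := by
        rw [← ENNReal.ofReal_add (by positivity) (by positivity),
          ← ENNReal.ofReal_add (by positivity) (by positivity)]
        exact ENNReal.ofReal_le_ofReal (by nlinarith)
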